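/- Let $\mathbb{D}=\{z\in\mathbb{C}:|z|<1\}$ and, for $a\in\mathbb{D}$, let $\tau_a(z)=\dfrac{a-z}{1-\overline{a}z}$. For an analytic function $g$ on $\mathbb{D}$ put $$\|g\|_{H^2}=\Bigl(\sup_{0<r<1}\frac{1}{2\pi}\int_0^{2\pi}|g(re^{i\theta})|^2\,d\theta\Bigr)^{1/2}\in[0,\infty].$$ Let $BMOA$ be the set of analytic functions $f$ on $\mathbb{D}$ with $\sup_{a\in\mathbb{D}}\|f\circ\tau_a-f(a)\|_{H^2}<\infty$, and let $VMOA$ be the set of $f\in BMOA$ such that $\lim_{|a|\to1^-}\|f\circ\tau_a-f(a)\|_{H^2}=0$. For every real $s>0$, the function $$f_s(z)=\exp\left(\frac{s(z+1)}{z-1}\right)\qquad(z\in\mathbb{D})$$ is not in $VMOA$. For every real $t\neq0$, the function $$f_t(z)=\left(\frac{1+z}{1-z}\right)^{it}=\exp\left(it\log\frac{1+z}{1-z}\right)\qquad(z\in\mathbb{D}),$$ where $\log$ is the principal branch of the logarithm, is not in $VMOA$. -/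

import Mathlib

open scoped ENNReal Topology

noncomputable section

namespace DiskSpaces

/-- The open unit disk `𝔻 = {z ∈ ℂ : |z| < 1}`. -/
def disk : Set ℂ := Metric.ball 0 1

/-- The involutive disk automorphism `τ_a(z) = (a - z) / (1 - conj(a) z)`, for `a ∈ 𝔻`. -/
def tau (a z : ℂ) : ℂ := (a - z) / (1 - (starRingEnd ℂ) a * z)

/-- The Hardy norm `‖g‖_{H²} = (sup_{0 < r < 1} (1 / 2π) ∫_0^{2π} |g(r e^{iθ})|² dθ)^{1/2}`,
as an extended nonnegative number, so that it is `∞` exactly when the supremum is infinite. -/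
def hardyNorm (g : ℂ → ℂ) : ℝ≥0∞ :=
  (⨆ r ∈ Set.Ioo (0 : ℝ) 1,
    (∫⁻ θ in Set.Ioc (0 : ℝ) (2 * Real.pi),
      ‖g ((r : ℂ) * Complex.exp ((θ : ℂ) * Complex.I))‖ₑ ^ 2) /
        ENNReal.ofReal (2 * Real.pi)) ^ (1 / 2 : ℝ)

/-- The Möbius-transported oscillation `‖f ∘ τ_a - f(a)‖_{H²}`. -/
def mobiusOsc (f : ℂ → ℂ) (a : ℂ) : ℝ≥0∞ :=
  hardyNorm (fun z => f (tau a z) - f a)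

/-- `BMOA`: the functions `f` analytic on `𝔻` with `sup_{a ∈ 𝔻} ‖f ∘ τ_a - f(a)‖_{H²} < ∞`.
A function on `𝔻` is represented by any function on `ℂ` extending it; only the values on `𝔻`
matter for membership. -/
def BMOA : Set (ℂ → ℂ) :=
  {f | DifferentiableOn ℂ f disk ∧ (⨆ a ∈ disk, mobiusOsc f a) < ∞}

/-- `VMOA`: the functions `f ∈ BMOA` with `‖f ∘ τ_a - f(a)‖_{H²} → 0` as `|a| → 1`, `a ∈ 𝔻`. -/
def VMOA : Set (ℂ → ℂ) :=
  {f | f ∈ BMOA ∧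
    Filter.Tendsto (mobiusOsc f) (Filter.comap (fun a : ℂ => ‖a‖) (𝓝[<] (1 : ℝ))) (𝓝 0)}

/-- `f_s(z) = exp(s (z + 1) / (z - 1))`. -/
def expFun (s : ℝ) (z : ℂ) : ℂ := Complex.exp ((s : ℂ) * (z + 1) / (z - 1))

/-- `f_t(z) = ((1 + z) / (1 - z))^{it}`, with the principal branch of the power. -/
def powFun (t : ℝ) (z : ℂ) : ℂ := ((1 + z) / (1 - z)) ^ (Complex.I * (t : ℂ))

end DiskSpaces

end

/-!
Membership in `VMOA` forces the little Bloch condition `(1 - |a|²) |f'(a)| → 0` as `|a| → 1`: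
the function `g = f ∘ τ_a - f(a)` has `|g'(0)| = (1 - |a|²) |f'(a)|`, and Cauchy's formula on the
circle of radius `1/2`, followed by the Cauchy-Schwarz inequality, gives `|g'(0)| ≤ 2 ‖g‖_{H²}`
(`enorm_deriv_zero_le_hardyNorm`, `enorm_bloch_le_mobiusOsc`).

Both families violate this condition along a curve ending at the boundary point `1`.
For `f_t` the curve is the radius `(0, 1)`, where `|f_t| = 1` and `(1 - x²) |f_t'(x)| = 2 |t|`.
For `f_s` it is the horocycle `1 - |z|² = |1 - z|²`, that is, `(1 + z) / (1 - z) = 1 + i y`, where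
`|f_s| = e^{-s}` and `(1 - |z|²) |f_s'(z)| = 2 s e^{-s}`.
-/

namespace DiskSpaces

open MeasureTheory Filter

/-! ### Disk automorphisms -/

theorem normSq_one_sub_conj_mul_sub (a z : ℂ) :
    ‖1 - (starRingEnd ℂ) a * z‖ ^ 2 - ‖a - z‖ ^ 2 = (1 - ‖a‖ ^ 2) * (1 - ‖z‖ ^ 2) := by
  simp only [← Complex.normSq_eq_norm_sq, Complex.normSq_apply, Complex.sub_re, Complex.sub_im,
    Complex.mul_re, Complex.mul_im, Complex.conj_re, Complex.conj_im, Complex.one_re,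
    Complex.one_im]
  ring

theorem norm_sub_lt_norm_one_sub_conj_mul {a z : ℂ} (ha : ‖a‖ < 1) (hz : ‖z‖ < 1) :
    ‖a - z‖ < ‖1 - (starRingEnd ℂ) a * z‖ := by
  have h := normSq_one_sub_conj_mul_sub a z
  have h1 : 0 < (1 - ‖a‖ ^ 2) * (1 - ‖z‖ ^ 2) :=
    mul_pos (by nlinarith [norm_nonneg a]) (by nlinarith [norm_nonneg z])
  exact lt_of_pow_lt_pow_left₀ 2 (norm_nonneg _) (by linarith)

theorem one_sub_conj_mul_ne_zero {a z : ℂ} (ha : ‖a‖ < 1) (hz : ‖z‖ < 1) :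
    1 - (starRingEnd ℂ) a * z ≠ 0 :=
  norm_pos_iff.1 ((norm_nonneg _).trans_lt (norm_sub_lt_norm_one_sub_conj_mul ha hz))

theorem tau_mem_disk {a z : ℂ} (ha : ‖a‖ < 1) (hz : ‖z‖ < 1) : tau a z ∈ disk := by
  have h := norm_sub_lt_norm_one_sub_conj_mul ha hz
  rw [disk, mem_ball_zero_iff, tau, norm_div, div_lt_one ((norm_nonneg _).trans_lt h)]
  exact h

theorem tau_zero (a : ℂ) : tau a 0 = a := by simp [tau]

theorem hasDerivAt_tau_zero (a : ℂ) : HasDerivAt (tau a) (-(1 - (‖a‖ : ℂ) ^ 2)) 0 := by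
  have h1 : HasDerivAt (fun z : ℂ => a - z) (-1) 0 := (hasDerivAt_id 0).const_sub a
  have h2 : HasDerivAt (fun z : ℂ => 1 - (starRingEnd ℂ) a * z) (-((starRingEnd ℂ) a * 1)) 0 :=
    ((hasDerivAt_id (0 : ℂ)).const_mul _).const_sub 1
  have h := h1.div h2 (by simp)
  refine h.congr_deriv ?_
  rw [← Complex.mul_conj']
  simp
  ring

theorem differentiableOn_tau {a : ℂ} (ha : ‖a‖ < 1) : DifferentiableOn ℂ (tau a) disk := by
  intro z hz
  refine DifferentiableAt.differentiableWithinAt ?_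
  have hne := one_sub_conj_mul_ne_zero ha (mem_ball_zero_iff.1 hz)
  unfold tau
  fun_prop (disch := exact hne)

/-! ### The Bloch condition -/

/-- The norm of the Taylor coefficient `g'(0)` is controlled by the Hardy norm. The constant `2`
comes from using only the circle of radius `1/2`. -/
theorem enorm_deriv_zero_le_hardyNorm {g : ℂ → ℂ} (hg : DifferentiableOn ℂ g disk) :
    ‖deriv g 0‖ₑ ≤ 2 * hardyNorm g := by
  have hpi := Real.pi_pos
  set u : ℝ → ℂ := fun θ => g (((1 / 2 : ℝ) : ℂ) * Complex.exp ((θ : ℂ) * Complex.I)) with hu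
  set μ : Measure ℝ := volume.restrict (Set.Ioc (0 : ℝ) (2 * Real.pi)) with hμ
  have hμu : μ Set.univ = ENNReal.ofReal (2 * Real.pi) := by simp [hμ]
  have hcont : Continuous u := by
    refine hg.continuousOn.comp_continuous (by fun_prop) fun θ => ?_
    rw [disk, mem_ball_zero_iff, norm_mul, Complex.norm_exp_ofReal_mul_I, Complex.norm_real]
    norm_num
  have hcauchy := Complex.two_pi_I_inv_smul_circleIntegral_sub_sq_inv_smul_of_differentiable
    (U := disk) (c := 0) (w₀ := 0) (R := 1 / 2) Metric.isOpen_ball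
    (Metric.closedBall_subset_ball (by norm_num)) hg (by simp)
  have hnorm : ‖deriv g 0‖ ≤ (2 * Real.pi)⁻¹ * (2 * ∫ θ, ‖u θ‖ ∂μ) := by
    rw [← hcauchy, norm_smul]
    have h1 : ‖(2 * Real.pi * Complex.I : ℂ)⁻¹‖ = (2 * Real.pi)⁻¹ := by
      simp [abs_of_pos hpi]
    rw [h1]
    refine mul_le_mul_of_nonneg_left ?_ (by positivity)
    rw [circleIntegral, intervalIntegral.integral_of_le (by positivity), ← integral_const_mul]
    refine (norm_integral_le_integral_norm _).trans (le_of_eq ?_)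
    refine integral_congr_ae (Eventually.of_forall fun θ => ?_)
    simp only [deriv_circleMap, norm_smul, norm_mul, norm_inv, norm_pow, sub_zero,
      Complex.norm_I, hu, circleMap, zero_add]
    norm_num
    ring
  have hint : Integrable u μ := (hcont.integrableOn_Icc).mono_set Set.Ioc_subset_Icc_self
  have hnorm' : ‖deriv g 0‖ₑ ≤ (ENNReal.ofReal (2 * Real.pi))⁻¹ * (2 * eLpNorm u 1 μ) := by
    rw [eLpNorm_one_eq_lintegral_enorm, ← ofReal_integral_norm_eq_lintegral_enorm hint,
      ← ofReal_norm, ← ENNReal.ofReal_inv_of_pos (by positivity),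
      ← ENNReal.ofReal_ofNat 2, ← ENNReal.ofReal_mul (by norm_num),
      ← ENNReal.ofReal_mul (by positivity)]
    exact ENNReal.ofReal_le_ofReal hnorm
  have hCS := eLpNorm_le_eLpNorm_mul_rpow_measure_univ (μ := μ) (p := 1) (q := 2) (by norm_num)
    hcont.aestronglyMeasurable
  have hL2 : eLpNorm u 2 μ = (∫⁻ θ, ‖u θ‖ₑ ^ 2 ∂μ) ^ (1 / 2 : ℝ) := by
    rw [eLpNorm_eq_lintegral_rpow_enorm_toReal (by norm_num) (by norm_num)]
    simp
  have hle : ((∫⁻ θ, ‖u θ‖ₑ ^ 2 ∂μ) / ENNReal.ofReal (2 * Real.pi)) ^ (1 / 2 : ℝ)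
      ≤ hardyNorm g := by
    refine ENNReal.rpow_le_rpow ?_ (by norm_num)
    exact le_iSup₂_of_le (1 / 2 : ℝ) (by norm_num) le_rfl
  have h0 : ENNReal.ofReal (2 * Real.pi) ≠ 0 := by simpa using hpi
  have ht : ENNReal.ofReal (2 * Real.pi) ≠ ∞ := ENNReal.ofReal_ne_top
  rw [hL2, hμu] at hCS
  rw [show 1 / (1 : ℝ≥0∞).toReal - 1 / (2 : ℝ≥0∞).toReal = (1 / 2 : ℝ) by norm_num] at hCS
  set M := ENNReal.ofReal (2 * Real.pi) with hM
  set A := ∫⁻ θ, ‖u θ‖ₑ ^ 2 ∂μ with hA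
  have hMM : M⁻¹ * M ^ (1 / 2 : ℝ) = (M⁻¹) ^ (1 / 2 : ℝ) := by
    rw [← ENNReal.rpow_neg_one, ← ENNReal.rpow_add _ _ h0 ht, ← ENNReal.rpow_mul]
    norm_num
  calc ‖deriv g 0‖ₑ ≤ M⁻¹ * (2 * (A ^ (1 / 2 : ℝ) * M ^ (1 / 2 : ℝ))) :=
        hnorm'.trans (by gcongr)
    _ = 2 * (A ^ (1 / 2 : ℝ) * (M⁻¹ * M ^ (1 / 2 : ℝ))) := by ring
    _ = 2 * (A / M) ^ (1 / 2 : ℝ) := by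
        rw [hMM, div_eq_mul_inv A M, ENNReal.mul_rpow_of_nonneg _ _ (by norm_num)]
    _ ≤ 2 * hardyNorm g := by gcongr

/-- The Möbius-invariant derivative `(1 - |a|²) f'(a)` is, up to sign, the derivative of
`f ∘ τ_a` at `0`, so it is controlled by the Möbius-transported oscillation. -/
theorem enorm_bloch_le_mobiusOsc {f : ℂ → ℂ} (hf : DifferentiableOn ℂ f disk) {a f' : ℂ}
    (ha : ‖a‖ < 1) (hfa : HasDerivAt f f' a) :
    ENNReal.ofReal ((1 - ‖a‖ ^ 2) * ‖f'‖) ≤ 2 * mobiusOsc f a := by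
  have hd : DifferentiableOn ℂ (fun z => f (tau a z) - f a) disk :=
    (hf.comp (differentiableOn_tau ha) fun z hz =>
      tau_mem_disk ha (mem_ball_zero_iff.1 hz)).sub_const _
  have h0 : HasDerivAt (fun z => f (tau a z) - f a) (f' * -(1 - (‖a‖ : ℂ) ^ 2)) 0 :=
    (HasDerivAt.comp 0 ((tau_zero a).symm ▸ hfa) (hasDerivAt_tau_zero a)).sub_const _
  refine le_of_eq_of_le ?_ (enorm_deriv_zero_le_hardyNorm hd)
  have h1 : (1 - (‖a‖ : ℂ) ^ 2) = ((1 - ‖a‖ ^ 2 : ℝ) : ℂ) := by push_cast; rfl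
  have h2 : 0 ≤ 1 - ‖a‖ ^ 2 := by nlinarith [norm_nonneg a]
  rw [h0.deriv, ← ofReal_norm, norm_mul, norm_neg, h1, Complex.norm_real,
    Real.norm_of_nonneg h2, mul_comm]

/-- A function whose Möbius-invariant derivative stays bounded away from `0` along some curve
going to the unit circle is not in `VMOA`. -/
theorem notMem_VMOA_of_bloch_lower_bound {ι : Type*} {l : Filter ι} [l.NeBot] {f : ℂ → ℂ}
    {γ f' : ι → ℂ} {c : ℝ} (hc : 0 < c) (hγ : Tendsto (fun i => ‖γ i‖) l (𝓝[<] 1))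
    (hf' : ∀ᶠ i in l, HasDerivAt f (f' i) (γ i))
    (hbound : ∀ᶠ i in l, c ≤ (1 - ‖γ i‖ ^ 2) * ‖f' i‖) : f ∉ VMOA := by
  rintro ⟨⟨hf, -⟩, hlim⟩
  have h1 : Tendsto (fun i => 2 * mobiusOsc f (γ i)) l (𝓝 0) := by
    simpa using ENNReal.Tendsto.const_mul (hlim.comp (tendsto_comap_iff.2 hγ))
      (Or.inr (ENNReal.ofNat_ne_top (n := 2)))
  have hlt : ∀ᶠ i in l, ‖γ i‖ < 1 := hγ.eventually self_mem_nhdsWithin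
  have h2 : ENNReal.ofReal c ≤ 0 := by
    refine ge_of_tendsto h1 ?_
    filter_upwards [hlt, hf', hbound] with i hi hd hb
    exact (ENNReal.ofReal_le_ofReal hb).trans (enorm_bloch_le_mobiusOsc hf hi hd)
  simp only [nonpos_iff_eq_zero, ENNReal.ofReal_eq_zero] at h2
  linarith

/-! ### The two families -/

theorem expFun_notMem_VMOA {s : ℝ} (hs : 0 < s) : expFun s ∉ VMOA := by
  have hne : ∀ y : ℝ, (2 + y * Complex.I : ℂ) ≠ 0 := fun y h => by
    simpa using congrArg Complex.re h
  have hden : ∀ y : ℝ, ‖(2 + y * Complex.I : ℂ)‖ ^ 2 = 4 + y ^ 2 := fun y => by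
    rw [← Complex.normSq_eq_norm_sq, Complex.normSq_apply]
    simp
    ring
  -- `γ y` is the point of the horocycle at which `(1 + z) / (1 - z) = 1 + i y`.
  set γ : ℝ → ℂ := fun y => y * Complex.I / (2 + y * Complex.I) with hγ
  have hγ1 : ∀ y, γ y - 1 = -2 / (2 + y * Complex.I) := fun y => by
    have := hne y
    simp only [hγ]
    field_simp
    ring
  have hγ1' : ∀ y, γ y - 1 ≠ 0 := fun y => by
    rw [hγ1]
    exact div_ne_zero (by norm_num) (hne y)
  have hnorm : ∀ y, ‖γ y‖ ^ 2 = 1 - 4 / (4 + y ^ 2) := fun y => by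
    have h4 : (4 + y ^ 2 : ℝ) ≠ 0 := by positivity
    simp only [hγ, norm_div, div_pow, hden, norm_mul, Complex.norm_I, Complex.norm_real,
      Real.norm_eq_abs, mul_one, sq_abs]
    field_simp
    ring
  refine notMem_VMOA_of_bloch_lower_bound (l := atTop) (γ := γ) (c := 2 * s * Real.exp (-s))
    (f' := fun y => Complex.exp (s * (γ y + 1) / (γ y - 1)) *
      ((s * 1 * (γ y - 1) - s * (γ y + 1) * 1) / (γ y - 1) ^ 2))
    (by positivity) ?_ (Eventually.of_forall fun y => ?_) (Eventually.of_forall fun y => ?_)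
  · refine tendsto_nhdsWithin_iff.2 ⟨?_, Eventually.of_forall fun y => ?_⟩
    · have h1 : Tendsto (fun y : ℝ => 4 + y ^ 2) atTop atTop :=
        tendsto_atTop_add_const_left _ _ (tendsto_pow_atTop two_ne_zero)
      have h2 : Tendsto (fun y : ℝ => √(1 - 4 / (4 + y ^ 2))) atTop (𝓝 1) := by
        simpa using ((tendsto_const_nhds.div_atTop h1 (a := 4)).const_sub 1).sqrt
      refine h2.congr fun y => ?_
      rw [← hnorm, Real.sqrt_sq (norm_nonneg _)]
    · have h : 0 < 4 / (4 + y ^ 2) := by positivity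
      have h' := hnorm y
      rw [Set.mem_Iio, ← sq_lt_one_iff₀ (norm_nonneg _)]
      linarith
  · have h1 : HasDerivAt (fun z : ℂ => (s : ℂ) * (z + 1)) (s * 1) (γ y) :=
      ((hasDerivAt_id _).add_const 1).const_mul _
    have h2 : HasDerivAt (fun z : ℂ => z - 1) 1 (γ y) := (hasDerivAt_id _).sub_const 1
    exact (h1.div h2 (hγ1' y)).cexp
  · have hexp : (s * (γ y + 1) / (γ y - 1) : ℂ) = -(s * (1 + y * Complex.I)) := by
      rw [div_eq_iff (hγ1' y), show γ y + 1 = (γ y - 1) + 2 by ring, hγ1]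
      have := hne y
      field_simp
      ring
    have hrat : ((s * 1 * (γ y - 1) - s * (γ y + 1) * 1) / (γ y - 1) ^ 2 : ℂ)
        = -(s / 2) * (2 + y * Complex.I) ^ 2 := by
      rw [show (s * 1 * (γ y - 1) - s * (γ y + 1) * 1 : ℂ) = -2 * s by ring, hγ1]
      have := hne y
      field_simp
    have h4 : (4 + y ^ 2 : ℝ) ≠ 0 := by positivity
    refine le_of_eq ?_
    rw [hexp, hrat, hnorm, norm_mul, Complex.norm_exp, norm_mul, norm_pow, hden]
    simp [abs_of_pos hs]
    field_simp
    norm_num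

theorem powFun_notMem_VMOA {t : ℝ} (ht : t ≠ 0) : powFun t ∉ VMOA := by
  have hev : ∀ᶠ x : ℝ in 𝓝[<] 1, 0 < x ∧ x < 1 :=
    (eventually_nhdsWithin_of_eventually_nhds (lt_mem_nhds one_pos)).and self_mem_nhdsWithin
  refine notMem_VMOA_of_bloch_lower_bound (l := 𝓝[<] (1 : ℝ)) (γ := fun x : ℝ => (x : ℂ))
    (c := 2 * |t|)
    (f' := fun x => (Complex.I * t) * ((1 + x) / (1 - x) : ℂ) ^ (Complex.I * t - 1) *
      ((1 * (1 - x) - (1 + x) * (-1)) / (1 - x) ^ 2))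
    (by positivity) ?_ ?_ ?_
  · refine tendsto_id.congr' ?_
    filter_upwards [hev] with x hx
    simp [abs_of_pos hx.1]
  · filter_upwards [hev] with x hx
    have h1 : HasDerivAt (fun z : ℂ => 1 + z) 1 (x : ℂ) := (hasDerivAt_id _).const_add 1
    have h2 : HasDerivAt (fun z : ℂ => 1 - z) (-1) (x : ℂ) := (hasDerivAt_id _).const_sub 1
    have h3 : (1 - x : ℂ) ≠ 0 := by exact_mod_cast (sub_pos.2 hx.2).ne'
    refine (h1.div h2 h3).cpow_const ?_
    have h4 : ((1 + x) / (1 - x) : ℂ) = ((1 + x) / (1 - x) : ℝ) := by push_cast; rfl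
    simp only [Pi.div_apply]
    rw [h4, Complex.ofReal_mem_slitPlane]
    exact div_pos (by linarith) (by linarith)
  · filter_upwards [hev] with x hx
    have h1 : 0 < 1 + x := by linarith
    have h2 : 0 < 1 - x := by linarith
    have h4 : ((1 + x) / (1 - x) : ℂ) = ((1 + x) / (1 - x) : ℝ) := by push_cast; rfl
    have h5 : ((1 * (1 - x) - (1 + x) * (-1)) / (1 - x) ^ 2 : ℂ) = (2 / (1 - x) ^ 2 : ℝ) := by
      push_cast
      ring
    refine le_of_eq ?_
    rw [h4, h5, norm_mul, norm_mul, Complex.norm_cpow_eq_rpow_re_of_pos (div_pos h1 h2),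
      Complex.norm_real, Complex.norm_real, Real.norm_of_nonneg hx.1.le,
      Real.norm_of_nonneg (div_nonneg zero_le_two (sq_nonneg _))]
    simp [Real.rpow_neg_one]
    field_simp
    ring

end DiskSpaces

theorem mainTheorem7 :
    (∀ s : ℝ, 0 < s → DiskSpaces.expFun s ∉ DiskSpaces.VMOA) ∧
      (∀ t : ℝ, t ≠ 0 → DiskSpaces.powFun t ∉ DiskSpaces.VMOA) :=
  ⟨fun _ => DiskSpaces.expFun_notMem_VMOA, fun _ => DiskSpaces.powFun_notMem_VMOA⟩
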